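/- Write $\mathbb N=\{1<2<\cdots\}$ and $\mathbb N^\vee=\{\cdots<2^\vee<1^\vee\}$, and let $t$ be an indeterminate. Let $\mathscr U(t)$ be the unital associative $\mathbb Q[t,t^{-1}]$-algebra generated by $u_i$ and $u_{i^\vee}$ ($i\in\mathbb N$) subject to the following relations, where $i,j,k\in\mathbb N$: $$u_iu_ju_k=u_iu_ku_j,\qquad u_{k^\vee}u_{j^\vee}u_{i^\vee}=u_{j^\vee}u_{k^\vee}u_{i^\vee}\qquad (j\le i<k),$$ $$u_ju_ku_i=u_ku_ju_i,\qquad u_{i^\vee}u_{k^\vee}u_{j^\vee}=u_{i^\vee}u_{j^\vee}u_{k^\vee}\qquad (j<i\le k),$$ $$u_{i+1}u_{(i+1)^\vee}=u_{i^\vee}u_i\quad(i\ge 1),\qquad u_1u_{1^\vee}=t,\qquad u_iu_{j^\vee}=u_{j^\vee}u_i\quad(i\ne j).$$ For a finite word $w=w_1\cdots w_r$ with letters in $\mathbb N\cup\mathbb N^\vee$ put $u_w=u_{w_1}\cdots u_{w_r}$ (and $u_w=1$ if $r=0$). For partitions $\mu,\nu$, let $\mathcal B_{\mu,\nu}$ be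 the set of pairs $(S,T)$ such that: $S$ is a semistandard tableau of shape $\mu$ with entries in $\mathbb N$ (rows weakly increasing, columns strictly increasing); $T$ is a semistandard tableau with entries in $\mathbb N^\vee$ whose shape is the diagram of $\nu$ rotated by $180^\circ$; and for every $k\ge 1$ the number of entries $\le k$ in the leftmost column of $S$ plus the number of entries $\ge k^\vee$ in the rightmost column of $T$ is at most $k$. The column word of a tableau is obtained by reading its columns from right to left, and each column from top to bottom. Let $u_S$ and $u_T$ be the monomials of the column words of $S$ and $T$, and put $u_{(S,T)}=u_Su_T$. Proposition. For every word $w=w_1\cdots w_r$ with letters in $\mathbb N\cup\mathbb N^\vee$ there exist partitions $\mu,\nu$ and $(S,T)\in\mathcal B_{\mu,\nu}$ such that $r-|\mu|-|\nu|$ is a nonnegative even integer and $$u_w=t^{\epsilon}\,u_{(S,T)},\qquad \epsilon=\frac{r-|\mu|-|\nu|}{2}.$$ -/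

import Mathlib

namespace RationalPlactic

/-- The alphabet `ℕ ∪ ℕ^∨`, where `ℕ = {1 < 2 < ⋯}`: the letter `pos i` is `i`, and the letter
`dual i` is `i^∨`. Finite words over it are lists of letters. -/
inductive Letter where
  | pos (i : ℕ+) : Letter
  | dual (i : ℕ+) : Letter

/-- The ground ring `ℚ[t, t⁻¹]`. -/
abbrev Ground : Type := LaurentPolynomial ℚ

/-- The generator of the free algebra attached to `i ∈ ℕ`. -/
noncomputable def gen (i : ℕ+) : FreeAlgebra Ground Letter :=
  FreeAlgebra.ι Ground (Letter.pos i)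

/-- The generator of the free algebra attached to `i^∨ ∈ ℕ^∨`. -/
noncomputable def genDual (i : ℕ+) : FreeAlgebra Ground Letter :=
  FreeAlgebra.ι Ground (Letter.dual i)

/-- The defining relations of the plactic algebra: the two Knuth relations (for words that read
the columns of a tableau from right to left, each from top to bottom), their images under the
word-reversing duality `i ↦ i^∨`, and the relations between the two kinds of generators. -/
inductive PlacticRel : FreeAlgebra Ground Letter → FreeAlgebra Ground Letter → Prop
  | knuth₁ (i j k : ℕ+) (hji : j ≤ i) (hik : i < k) :
      PlacticRel (gen i * gen j * gen k) (gen i * gen k * gen j)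
  | knuth₂ (i j k : ℕ+) (hji : j < i) (hik : i ≤ k) :
      PlacticRel (gen j * gen k * gen i) (gen k * gen j * gen i)
  | dualKnuth₁ (i j k : ℕ+) (hji : j ≤ i) (hik : i < k) :
      PlacticRel (genDual k * genDual j * genDual i) (genDual j * genDual k * genDual i)
  | dualKnuth₂ (i j k : ℕ+) (hji : j < i) (hik : i ≤ k) :
      PlacticRel (genDual i * genDual k * genDual j) (genDual i * genDual j * genDual k)
  | shift (i : ℕ+) :
      PlacticRel (gen (i + 1) * genDual (i + 1)) (genDual i * gen i)
  | contract :
      PlacticRel (gen 1 * genDual 1)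
        (algebraMap Ground (FreeAlgebra Ground Letter) (LaurentPolynomial.T 1))
  | comm (i j : ℕ+) (hij : i ≠ j) :
      PlacticRel (gen i * genDual j) (genDual j * gen i)

/-- The plactic algebra `𝒰(t)`: the unital associative `ℚ[t, t⁻¹]`-algebra generated by the `u_i`
and `u_{i^∨}` subject to the relations `PlacticRel`. -/
abbrev PlacticAlgebra : Type := RingQuot PlacticRel

/-- The generators `u_a` of the plactic algebra, for a letter `a`. -/
noncomputable def u (a : Letter) : PlacticAlgebra :=
  RingQuot.mkAlgHom Ground PlacticRel (FreeAlgebra.ι Ground a)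

/-- The word monomial `u_w = u_{w_1} ⋯ u_{w_r}`. -/
noncomputable def uWord (w : List Letter) : PlacticAlgebra :=
  (w.map u).prod

/-- The entry of a semistandard tableau as an element of `{1 < 2 < ⋯}`. Mathlib's semistandard
tableaux have entries in `{0 < 1 < ⋯}`, with rows and columns numbered from `0`; we relabel the
entries by the order isomorphism `n ↦ n + 1`, so that `SemistandardYoungTableau μ` is the set of
all semistandard tableaux of shape `μ` with entries in `{1 < 2 < ⋯}`. -/
def entry {μ : YoungDiagram} (S : SemistandardYoungTableau μ) (i j : ℕ) : ℕ+ :=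
  Nat.succPNat (S i j)

/-- The column word of `S`: columns from right to left, each column from top to bottom. -/
def colWord {μ : YoungDiagram} (S : SemistandardYoungTableau μ) : List Letter :=
  (List.range (μ.rowLen 0)).reverse.flatMap fun j =>
    (List.range (μ.colLen j)).map fun i => Letter.pos (entry S i j)

/-- A tableau `T` of the rotated shape `ν^∨` with entries in `ℕ^∨ = {⋯ < 2^∨ < 1^∨}` is recorded
by its dual `T^∨`, the semistandard tableau of shape `ν` obtained by rotating `T` by 180 degrees
and replacing each entry `a^∨` by `a`; this is a bijection. The columns of `T` from right to left
are the columns of `T^∨` from left to right, and reading a column of `T` from top to bottom is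
reading the corresponding column of `T^∨` from bottom to top. So this is the column word of `T`,
in terms of `Q = T^∨`. -/
def dualColWord {ν : YoungDiagram} (Q : SemistandardYoungTableau ν) : List Letter :=
  (List.range (ν.rowLen 0)).flatMap fun j =>
    (List.range (ν.colLen j)).reverse.map fun i => Letter.dual (entry Q i j)

/-- The set `B_{μ,ν}` of rational semistandard tableaux `(S, T)`. The second tableau `T` has the
rotated shape `ν^∨` and entries in `ℕ^∨` and is recorded by `dualRight = T^∨`. The condition bounds
the number of entries `≤ k` in the leftmost column of `S` plus the number of entries `≥ k^∨` in the
rightmost column of `T` (that is, of entries `≤ k` in the leftmost column of `T^∨`). -/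
structure RationalTableau (μ ν : YoungDiagram) where
  left : SemistandardYoungTableau μ
  dualRight : SemistandardYoungTableau ν
  bound : ∀ k : ℕ+,
    ((Finset.range (μ.colLen 0)).filter fun i => entry left i 0 ≤ k).card +
      ((Finset.range (ν.colLen 0)).filter fun i => entry dualRight i 0 ≤ k).card ≤ (k : ℕ)

/-- The monomial `u_{(S,T)} = u_S u_T`, where `u_S` and `u_T` are the monomials of the column
words of `S` and `T`. -/
noncomputable def uTableau {μ ν : YoungDiagram} (P : RationalTableau μ ν) : PlacticAlgebra :=
  uWord (colWord P.left) * uWord (dualColWord P.dualRight)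

end RationalPlactic

/-! The mixed relations let every dual letter move right past the positive letters without changing
the length (`exists_uWord_eq_pos_mul_dual`). Column insertion then turns the positive part into the
column word of a tableau, and the dual part likewise in the opposite algebra (`exists_columnLists`).
Only the bound can still fail. It concerns the leftmost columns of `S` and `T^∨`, whose monomials
are adjacent in `u_S u_T`.

Push the dual column leftwards through the positive one. Either some `u_1 u_{1^∨}` appears, giving a
factor `t` and a word shorter by two, or the positive column becomes one disjoint from the dual
column, with at least as many entries `≤ k` for each `k`. Disjointness forces the bound for the new
column, hence for the original (`contracts_or_countP_le`). Induction on length finishes. -/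

namespace RationalPlactic

/-! ### Column insertion in a monoid satisfying the Knuth relations -/

section Knuth

variable {α M : Type*} [LinearOrder α] [Monoid M]

/-- A map to a monoid which satisfies the Knuth relations. -/
structure IsPlactic (f : α → M) : Prop where
  knuth₁ : ∀ i j k : α, j ≤ i → i < k → f i * f j * f k = f i * f k * f j
  knuth₂ : ∀ i j k : α, j < i → i ≤ k → f j * f k * f i = f k * f j * f i

namespace IsPlactic

variable {f : α → M}

/-- The letter `x` moves left through `R` one step at a time; the entry just before each crossed
letter is the witness for `knuth₁`. -/
theorem prod_mul_of_le (hf : IsPlactic f) (x : α) (R : List α) :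
    ∀ y : α, x ≤ y → (y :: R).Pairwise (· < ·) →
      f y * (R.map f).prod * f x = f y * f x * (R.map f).prod := by
  induction R with
  | nil => intro y _ _; simp
  | cons r R ih =>
    intro y hxy hs
    have hyr : y < r := (List.pairwise_cons.1 hs).1 r (by simp)
    have h := ih r (hxy.trans hyr.le) (List.pairwise_cons.1 hs).2
    calc f y * ((r :: R).map f).prod * f x
        = f y * (f r * (R.map f).prod * f x) := by simp [mul_assoc]
      _ = f y * f r * f x * (R.map f).prod := by rw [h]; simp [mul_assoc]
      _ = f y * f x * ((r :: R).map f).prod := by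
          rw [← hf.knuth₁ y x r hxy hyr]; simp [mul_assoc]

/-- Here `y` moves left through `L`; the witness for `knuth₂` is the letter after the crossed one,
which is `x` at the end of `L`. -/
theorem prod_mul_of_lt (hf : IsPlactic f) (x y : α) (hxy : x ≤ y) (L : List α)
    (hL : ∀ l ∈ L, l < x) (hs : L.Pairwise (· < ·)) :
    (L.map f).prod * f y * f x = f y * (L.map f).prod * f x := by
  induction L with
  | nil => simp
  | cons l L ih =>
    have h := ih (fun a ha => hL a (by simp [ha])) (List.pairwise_cons.1 hs).2
    have hlx : l < x := hL l (by simp)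
    calc ((l :: L).map f).prod * f y * f x
        = f l * ((L.map f).prod * f y * f x) := by simp [mul_assoc]
      _ = f l * f y * ((L.map f).prod * f x) := by rw [h]; simp [mul_assoc]
      _ = f y * f l * ((L.map f).prod * f x) := by
          cases L with
          | nil => simpa using hf.knuth₂ x l y hlx hxy
          | cons m L =>
            have hlm : l < m := (List.pairwise_cons.1 hs).1 m (by simp)
            have hmx : m < x := hL m (by simp)
            have := hf.knuth₂ m l y hlm (hmx.le.trans hxy)
            simp only [List.map_cons, List.prod_cons, ← mul_assoc]
            rw [this]
      _ = f y * ((l :: L).map f).prod * f x := by simp [mul_assoc]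

/-- Inserting `x` into a column bumps the smallest entry `y ≥ x`. -/
theorem prod_column_mul (hf : IsPlactic f) (x y : α) (hxy : x ≤ y) (L R : List α)
    (hL : ∀ l ∈ L, l < x) (hs : (L ++ y :: R).Pairwise (· < ·)) :
    ((L ++ y :: R).map f).prod * f x = f y * ((L ++ x :: R).map f).prod := by
  obtain ⟨hs₁, hs₂, -⟩ := List.pairwise_append.1 hs
  calc ((L ++ y :: R).map f).prod * f x
      = (L.map f).prod * (f y * (R.map f).prod * f x) := by simp [mul_assoc]
    _ = (L.map f).prod * f y * f x * (R.map f).prod := by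
        rw [hf.prod_mul_of_le x R y hxy hs₂]; simp [mul_assoc]
    _ = f y * ((L ++ x :: R).map f).prod := by
        rw [hf.prod_mul_of_lt x y hxy L hL hs₁]; simp [mul_assoc]

end IsPlactic

/-- The column `D` may stand directly to the right of the column `C` in a tableau. -/
def Dominates (C D : List α) : Prop :=
  ∀ (i : ℕ) (d : α), D[i]? = some d → ∃ c, C[i]? = some c ∧ c ≤ d

theorem Dominates.trans {C D E : List α} (h₁ : Dominates C D) (h₂ : Dominates D E) :
    Dominates C E := by
  intro i e he
  obtain ⟨d, hd, hde⟩ := h₂ i e he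
  obtain ⟨c, hc, hcd⟩ := h₁ i d hd
  exact ⟨c, hc, hcd.trans hde⟩

instance : IsTrans (List α) Dominates := ⟨fun _ _ _ h₁ h₂ => h₁.trans h₂⟩

theorem dominates_replace {x y : α} (hxy : x ≤ y) (L R : List α) :
    Dominates (L ++ x :: R) (L ++ y :: R) := by
  intro i d hd
  rcases lt_trichotomy i L.length with h | h | h
  · rw [List.getElem?_append_left h] at hd ⊢
    exact ⟨d, hd, le_rfl⟩
  · subst h
    simp_all
  · obtain ⟨n, rfl⟩ := Nat.exists_eq_add_of_lt h
    rw [List.getElem?_append_right (by omega)] at hd ⊢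
    rw [show L.length + n + 1 - L.length = n + 1 by omega] at hd ⊢
    simp_all

/-- The bumped `y` lands no lower than the row it left, since by domination the right-hand entry in
that row, if any, is `≥ y`. Using `S.tail` covers both bumping the head of `S` and appending when
`S` is empty. -/
theorem Dominates.insert {x y : α} (hxy : x ≤ y) {L R L' S : List α} (hL : ∀ l ∈ L, l < x)
    (hL' : ∀ l ∈ L', l < y) (h : Dominates (L ++ y :: R) (L' ++ S)) :
    Dominates (L ++ x :: R) (L' ++ y :: S.tail) := by
  have h' : Dominates (L ++ x :: R) (L' ++ S) := (dominates_replace hxy L R).trans h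
  have hlen : L'.length ≤ L.length := by
    by_contra! hlt
    obtain ⟨c, hc, hcd⟩ := h L.length L'[L.length] (by
      rw [List.getElem?_append_left hlt]; simp)
    simp only [List.getElem?_append_right le_rfl, Nat.sub_self, List.getElem?_cons_zero,
      Option.some.injEq] at hc
    subst hc
    exact absurd (hL' _ (List.getElem_mem hlt)) (not_lt.2 hcd)
  intro i d hd
  rcases lt_trichotomy i L'.length with hi | hi | hi
  · refine h' i d ?_
    rwa [List.getElem?_append_left hi] at hd ⊢
  · subst hi
    obtain rfl : y = d := by simpa using hd
    rcases hlen.lt_or_eq with hlt | heq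
    · exact ⟨L[L'.length], by rw [List.getElem?_append_left hlt]; simp,
        (hL _ (List.getElem_mem hlt)).le.trans hxy⟩
    · exact ⟨x, by simp [heq], hxy⟩
  · obtain ⟨n, rfl⟩ := Nat.exists_eq_add_of_lt hi
    refine h' _ d ?_
    rw [List.getElem?_append_right (by omega)] at hd ⊢
    rw [show L'.length + n + 1 - L'.length = n + 1 by omega] at hd ⊢
    cases S <;> simp_all

/-- The list of columns, from left to right, of a semistandard tableau. -/
structure IsColumnList (Cs : List (List α)) : Prop where
  ne_nil : ∀ C ∈ Cs, C ≠ []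
  pairwise_lt : ∀ C ∈ Cs, C.Pairwise (· < ·)
  isChain : Cs.IsChain Dominates

theorem isColumnList_cons {C : List α} {Cs : List (List α)} :
    IsColumnList (C :: Cs) ↔ C ≠ [] ∧ C.Pairwise (· < ·) ∧
      (∀ D ∈ Cs.head?, Dominates C D) ∧ IsColumnList Cs := by
  constructor
  · rintro ⟨h₁, h₂, h₃⟩
    rw [List.isChain_cons] at h₃
    exact ⟨h₁ C (by simp), h₂ C (by simp), h₃.1, fun D hD => h₁ D (by simp [hD]),
      fun D hD => h₂ D (by simp [hD]), h₃.2⟩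
  · rintro ⟨h₁, h₂, h₃, h₄⟩
    refine ⟨?_, ?_, List.isChain_cons.2 ⟨h₃, h₄.isChain⟩⟩
    · rintro D (_ | ⟨_, hD⟩)
      exacts [h₁, h₄.ne_nil D hD]
    · rintro D (_ | ⟨_, hD⟩)
      exacts [h₂, h₄.pairwise_lt D hD]

theorem exists_split_column (x : α) (C : List α) (hC : C.Pairwise (· < ·)) :
    (∀ c ∈ C, c < x) ∨ ∃ L y R, C = L ++ y :: R ∧ (∀ l ∈ L, l < x) ∧ x ≤ y := by
  induction C with
  | nil => simp
  | cons c C ih =>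
    rcases lt_or_ge c x with h | h
    · rcases ih (List.pairwise_cons.1 hC).2 with h' | ⟨L, y, R, rfl, hL, hy⟩
      · left; simpa [h] using h'
      · exact Or.inr ⟨c :: L, y, R, by simp, by simpa [h] using hL, hy⟩
    · exact Or.inr ⟨[], c, C, by simp, by simp, h⟩

/-- Column insertion. -/
theorem IsPlactic.exists_insert {f : α → M} (hf : IsPlactic f) (Cs : List (List α)) :
    ∀ x : α, IsColumnList Cs → ∃ C' Cs', IsColumnList (C' :: Cs') ∧
      (C' :: Cs').flatten.length = Cs.flatten.length + 1 ∧
      ((C' :: Cs').reverse.flatten.map f).prod = (Cs.reverse.flatten.map f).prod * f x ∧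
      ∃ L S, Cs.headD [] = L ++ S ∧ C' = L ++ x :: S.tail ∧ ∀ l ∈ L, l < x := by
  induction Cs with
  | nil =>
    intro x _
    refine ⟨[x], [], ⟨by simp, by simp, by simp⟩, by simp, by simp, [], [], by simp⟩
  | cons C Cs ih =>
    intro x h
    obtain ⟨hne, hlt, hdom, hCs⟩ := isColumnList_cons.1 h
    rcases exists_split_column x C hlt with hx | ⟨L, y, R, rfl, hL, hxy⟩
    · refine ⟨C ++ [x], Cs, isColumnList_cons.2 ⟨by simp, ?_, ?_, hCs⟩, ?_, ?_, C, [],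
        by simp, by simp, hx⟩
      · rw [List.pairwise_append]
        exact ⟨hlt, by simp, by simpa using hx⟩
      · intro D hD i d hd
        obtain ⟨c, hc, hcd⟩ := hdom D hD i d hd
        refine ⟨c, ?_, hcd⟩
        rw [List.getElem?_append_left]
        · exact hc
        · exact (List.getElem?_eq_some_iff.1 hc).1
      · simp; omega
      · simp [mul_assoc]
    -- The last conjunct of the induction hypothesis describes the new neighbouring column, as
    -- `Dominates.insert` requires.
    · obtain ⟨D', Cs', hT, hlen, hprod, L', S, hhead, rfl, hL'⟩ := ih y hCs
      refine ⟨L ++ x :: R, (L' ++ y :: S.tail) :: Cs', isColumnList_cons.2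
        ⟨by simp, ?_, ?_, hT⟩, ?_, ?_, L, y :: R, by simp, by simp, hL⟩
      · obtain ⟨h₁, h₂, h₃⟩ := List.pairwise_append.1 hlt
        obtain ⟨h₄, h₅⟩ := List.pairwise_cons.1 h₂
        refine List.pairwise_append.2 ⟨h₁, List.pairwise_cons.2
          ⟨fun r hr => hxy.trans_lt (h₄ r hr), h₅⟩, fun a ha b hb => ?_⟩
        rcases List.mem_cons.1 hb with rfl | hb
        · exact hL a ha
        · exact h₃ a ha b (by simp [hb])
      · intro D hD
        obtain rfl : L' ++ y :: S.tail = D := by simpa using hD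
        refine Dominates.insert hxy hL hL' ?_
        rw [← hhead]
        cases Cs with
        | nil => intro i d hd; simp at hd
        | cons D Cs => exact hdom D (by simp)
      · simp only [List.flatten_cons, List.length_append, List.length_cons] at hlen ⊢
        omega
      · have h₁ := hf.prod_column_mul x y hxy L R hL hlt
        rw [List.reverse_cons, List.flatten_append, List.map_append, List.prod_append, hprod,
          List.reverse_cons, List.flatten_append, List.map_append, List.prod_append, mul_assoc,
          mul_assoc]
        simp only [List.flatten_singleton]
        rw [h₁]

/-- Every word is plactically equivalent to the column word of a tableau. -/
theorem IsPlactic.exists_isColumnList {f : α → M} (hf : IsPlactic f) (w : List α) :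
    ∃ Cs, IsColumnList Cs ∧ Cs.flatten.length = w.length ∧
      (Cs.reverse.flatten.map f).prod = (w.map f).prod := by
  induction w using List.reverseRecOn with
  | nil => exact ⟨[], ⟨by simp, by simp, by simp⟩, by simp, by simp⟩
  | append_singleton w x ih =>
    obtain ⟨Cs, hCs, hlen, hprod⟩ := ih
    obtain ⟨C', Cs', h₁, h₂, h₃, -⟩ := hf.exists_insert Cs x hCs
    exact ⟨C' :: Cs', h₁, by rw [h₂, hlen]; simp, by rw [h₃, hprod]; simp⟩

end Knuth

/-! ### Column lists as semistandard Young tableaux -/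

section Realization

theorem IsColumnList.dominates {Cs : List (List ℕ+)} (h : IsColumnList Cs) {i j : ℕ}
    (hij : i ≤ j) : Dominates (Cs.getD i []) (Cs.getD j []) := by
  rcases hij.eq_or_lt with rfl | hij
  · exact fun _ d hd => ⟨d, hd, le_rfl⟩
  by_cases hj : j < Cs.length
  · rw [List.getD_eq_getElem _ _ hj, List.getD_eq_getElem _ _ (hij.trans hj)]
    exact List.pairwise_iff_getElem.1 h.isChain.pairwise i j _ _ hij
  · rw [List.getD_eq_default _ _ (not_lt.1 hj)]
    intro _ _ hd
    simp at hd

theorem Dominates.length_le {C D : List ℕ+} (h : Dominates C D) : D.length ≤ C.length := by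
  by_contra! hlt
  obtain ⟨c, hc, -⟩ := h C.length D[C.length] (by simp)
  simp at hc

theorem Dominates.getD_le {C D : List ℕ+} (h : Dominates C D) {i : ℕ} (hi : i < D.length) :
    C.getD i 1 ≤ D.getD i 1 := by
  obtain ⟨c, hc, hcd⟩ := h i D[i] (by simp)
  rw [List.getD_eq_getElem _ _ hi, List.getD_eq_getElem?_getD, hc]
  exact hcd

/-- The diagram whose columns have the lengths of the given columns. -/
def shape (Cs : List (List ℕ+)) (h : IsColumnList Cs) : YoungDiagram where
  cells := (Finset.range Cs.length).biUnion fun j =>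
    Finset.range (Cs.getD j []).length ×ˢ {j}
  isLowerSet := by
    rintro ⟨i, j⟩ ⟨i', j'⟩ ⟨hi, hj⟩ hm
    simp only [Finset.coe_biUnion, Set.mem_iUnion, Finset.mem_coe, Finset.mem_range,
      Finset.mem_product, Finset.mem_singleton, exists_prop] at hm ⊢
    obtain ⟨k, hk, hik, rfl⟩ := hm
    simp only at hi hj
    exact ⟨j', hj.trans_lt hk, hi.trans_lt (hik.trans_le (h.dominates hj).length_le), rfl⟩

theorem mem_shape {Cs : List (List ℕ+)} (h : IsColumnList Cs) {i j : ℕ} :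
    (i, j) ∈ shape Cs h ↔ i < (Cs.getD j []).length := by
  rw [← YoungDiagram.mem_cells, shape]
  simp only [Finset.mem_biUnion, Finset.mem_range, Finset.mem_product, Finset.mem_singleton]
  constructor
  · rintro ⟨k, -, h, rfl⟩; exact h
  · intro h
    refine ⟨j, ?_, h, rfl⟩
    by_contra hj
    rw [List.getD_eq_default _ _ (not_lt.1 hj)] at h
    simp at h

theorem map_getD_range {β : Type*} (l : List β) (d : β) :
    (List.range l.length).map (fun i => l.getD i d) = l := by
  apply List.ext_getElem <;> simp +contextual

theorem card_shape {Cs : List (List ℕ+)} (h : IsColumnList Cs) :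
    (shape Cs h).card = Cs.flatten.length := by
  rw [YoungDiagram.card, shape, Finset.card_biUnion]
  · simp only [Finset.card_product, Finset.card_range, Finset.card_singleton, mul_one]
    conv_rhs => rw [← map_getD_range Cs []]
    rw [List.length_flatten, List.map_map, Finset.sum_range, ← List.sum_ofFn, List.ofFn_eq_map,
      ← List.map_coe_finRange_eq_range, List.map_map]
    rfl
  · intro a _ b _ hab
    simp only [Function.onFun, Finset.disjoint_left, Finset.mem_product, Finset.mem_singleton]
    rintro x ⟨-, rfl⟩ ⟨-, h⟩
    exact hab h

theorem colLen_shape {Cs : List (List ℕ+)} (h : IsColumnList Cs) (j : ℕ) :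
    (shape Cs h).colLen j = (Cs.getD j []).length :=
  eq_of_forall_lt_iff fun i => by rw [← YoungDiagram.mem_iff_lt_colLen, mem_shape]

theorem rowLen_shape {Cs : List (List ℕ+)} (h : IsColumnList Cs) :
    (shape Cs h).rowLen 0 = Cs.length :=
  eq_of_forall_lt_iff fun j => by
    rw [← YoungDiagram.mem_iff_lt_rowLen, mem_shape, List.length_pos_iff]
    by_cases hj : j < Cs.length
    · rw [List.getD_eq_getElem _ _ hj]
      simpa [hj] using h.ne_nil _ (List.getElem_mem hj)
    · rw [List.getD_eq_default _ _ (not_lt.1 hj)]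
      simpa using hj

/-- The semistandard tableau with the given columns. -/
def tableau (Cs : List (List ℕ+)) (h : IsColumnList Cs) :
    SemistandardYoungTableau (shape Cs h) where
  -- The default `1` has `natPred` equal to `0`, the value required outside the diagram.
  entry i j := ((Cs.getD j []).getD i 1).natPred
  row_weak' := by
    intro i j₁ j₂ hj hm
    rw [mem_shape] at hm
    exact PNat.natPred_le_natPred.2 ((h.dominates hj.le).getD_le hm)
  col_strict' := by
    intro i₁ i₂ j hi hm
    rw [mem_shape] at hm
    rw [PNat.natPred_lt_natPred, List.getD_eq_getElem _ _ hm,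
      List.getD_eq_getElem _ _ (hi.trans hm)]
    refine List.pairwise_iff_getElem.1 ?_ i₁ i₂ _ _ hi
    have hj : j < Cs.length := by
      by_contra hj
      rw [List.getD_eq_default _ _ (not_lt.1 hj)] at hm
      simp at hm
    rw [List.getD_eq_getElem _ _ hj]
    exact h.pairwise_lt _ (List.getElem_mem hj)
  zeros' := by
    intro i j hm
    rw [mem_shape] at hm
    rw [List.getD_eq_default _ _ (not_lt.1 hm)]
    rfl

theorem map_entry_tableau {Cs : List (List ℕ+)} (h : IsColumnList Cs) (j : ℕ) :
    (List.range ((shape Cs h).colLen j)).map (fun i => entry (tableau Cs h) i j) =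
      Cs.getD j [] := by
  rw [colLen_shape]
  conv_rhs => rw [← map_getD_range (Cs.getD j []) 1]
  refine List.map_congr_left fun i _ => ?_
  change Nat.succPNat (((Cs.getD j []).getD i 1).natPred) = _
  simp

theorem colWord_tableau {Cs : List (List ℕ+)} (h : IsColumnList Cs) :
    colWord (tableau Cs h) = Cs.reverse.flatten.map Letter.pos := by
  have hm : ∀ j, (List.range ((shape Cs h).colLen j)).map
      (fun i => Letter.pos (entry (tableau Cs h) i j)) = (Cs.getD j []).map Letter.pos := by
    intro j
    rw [← map_entry_tableau h j, List.map_map]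
    rfl
  rw [colWord]
  simp only [hm, rowLen_shape]
  conv_rhs => rw [← map_getD_range Cs []]
  rw [← List.map_reverse, List.map_flatten, List.map_map, List.flatMap_def]
  rfl

theorem dualColWord_tableau {Cs : List (List ℕ+)} (h : IsColumnList Cs) :
    dualColWord (tableau Cs h) = Cs.reverse.flatten.reverse.map Letter.dual := by
  have hm : ∀ j, (List.range ((shape Cs h).colLen j)).reverse.map
      (fun i => Letter.dual (entry (tableau Cs h) i j)) =
        (Cs.getD j []).reverse.map Letter.dual := by
    intro j
    rw [← map_entry_tableau h j, ← List.map_reverse, List.map_map]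
    rfl
  rw [dualColWord]
  simp only [hm, rowLen_shape]
  rw [List.reverse_flatten, List.map_reverse, List.reverse_reverse]
  conv_rhs => rw [← map_getD_range Cs []]
  rw [List.map_flatten, List.map_map, List.map_map, List.flatMap_def]
  rfl

theorem card_filter_entry_tableau {Cs : List (List ℕ+)} (h : IsColumnList Cs) (k : ℕ+) :
    ((Finset.range ((shape Cs h).colLen 0)).filter
      fun i => entry (tableau Cs h) i 0 ≤ k).card = (Cs.headD []).countP (· ≤ k) := by
  have h₀ : Cs.headD [] = Cs.getD 0 [] := by cases Cs <;> rfl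
  rw [h₀, ← map_entry_tableau h 0, List.countP_map, ← Nat.count_eq_card_filter_range, Nat.count]
  rfl

end Realization

/-! ### Mixed relations, contraction, and the induction on length -/

section Relations

theorem u_pos (i : ℕ+) : u (.pos i) = RingQuot.mkAlgHom Ground PlacticRel (gen i) := rfl

theorem u_dual (i : ℕ+) : u (.dual i) = RingQuot.mkAlgHom Ground PlacticRel (genDual i) := rfl

theorem isPlactic_u_pos : IsPlactic fun i => u (.pos i) where
  knuth₁ i j k h₁ h₂ := by
    simpa only [map_mul, ← u_pos, ← u_dual] using RingQuot.mkAlgHom_rel Ground (PlacticRel.knuth₁ i j k h₁ h₂)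
  knuth₂ i j k h₁ h₂ := by
    simpa only [map_mul, ← u_pos, ← u_dual] using RingQuot.mkAlgHom_rel Ground (PlacticRel.knuth₂ i j k h₁ h₂)

/-- The dual relations are the Knuth relations read backwards, so insertion applies to reversed dual
words. -/
theorem isPlactic_op_u_dual : IsPlactic fun i => MulOpposite.op (u (.dual i)) where
  knuth₁ i j k h₁ h₂ := by
    have := RingQuot.mkAlgHom_rel Ground (PlacticRel.dualKnuth₁ i j k h₁ h₂)
    simp only [map_mul, ← u_dual] at this
    simp only [← MulOpposite.op_mul, ← mul_assoc, this]
  knuth₂ i j k h₁ h₂ := by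
    have := RingQuot.mkAlgHom_rel Ground (PlacticRel.dualKnuth₂ i j k h₁ h₂)
    simp only [map_mul, ← u_dual] at this
    simp only [← MulOpposite.op_mul, ← mul_assoc, this]

theorem u_pos_mul_u_dual_succ (i : ℕ+) :
    u (.pos (i + 1)) * u (.dual (i + 1)) = u (.dual i) * u (.pos i) := by
  simpa only [map_mul, ← u_pos, ← u_dual] using RingQuot.mkAlgHom_rel Ground (PlacticRel.shift i)

theorem u_pos_mul_u_dual_of_ne {i j : ℕ+} (h : i ≠ j) :
    u (.pos i) * u (.dual j) = u (.dual j) * u (.pos i) := by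
  simpa only [map_mul, ← u_pos, ← u_dual] using RingQuot.mkAlgHom_rel Ground (PlacticRel.comm i j h)

theorem u_pos_one_mul_u_dual_one :
    u (.pos 1) * u (.dual 1) = algebraMap Ground PlacticAlgebra (LaurentPolynomial.T 1) := by
  have := RingQuot.mkAlgHom_rel Ground PlacticRel.contract
  rwa [map_mul, AlgHom.commutes] at this

@[simp] theorem uWord_nil : uWord [] = 1 := rfl

@[simp] theorem uWord_cons (a : Letter) (w : List Letter) : uWord (a :: w) = u a * uWord w := by
  simp [uWord]

@[simp] theorem uWord_append (v w : List Letter) : uWord (v ++ w) = uWord v * uWord w := by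
  simp [uWord]

/-- Crossing a different index is commutation; crossing an equal index raises both indices by one,
so the move to the right is never blocked. -/
theorem u_dual_mul_uWord_pos (A : List ℕ+) : ∀ j : ℕ+, ∃ (A' : List ℕ+) (j' : ℕ+),
    A'.length = A.length ∧
      u (.dual j) * uWord (A.map .pos) = uWord (A'.map .pos) * u (.dual j') := by
  induction A with
  | nil => intro j; exact ⟨[], j, rfl, by simp⟩
  | cons a A ih =>
    intro j
    by_cases h : a = j
    · subst h
      obtain ⟨A', j', hl, he⟩ := ih (a + 1)
      refine ⟨(a + 1) :: A', j', by simp [hl], ?_⟩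
      simp only [List.map_cons, uWord_cons, mul_assoc, ← he]
      rw [← mul_assoc, ← u_pos_mul_u_dual_succ, mul_assoc]
    · obtain ⟨A', j', hl, he⟩ := ih j
      refine ⟨a :: A', j', by simp [hl], ?_⟩
      simp only [List.map_cons, uWord_cons, mul_assoc, ← he]
      rw [← mul_assoc, ← u_pos_mul_u_dual_of_ne h, mul_assoc]

/-- All dual letters of a word can be moved to the right. -/
theorem exists_uWord_eq_pos_mul_dual (w : List Letter) : ∃ A B : List ℕ+,
    A.length + B.length = w.length ∧
      uWord w = uWord (A.map .pos) * uWord (B.map .dual) := by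
  induction w with
  | nil => exact ⟨[], [], by simp, by simp⟩
  | cons a w ih =>
    obtain ⟨A, B, hl, he⟩ := ih
    cases a with
    | pos i => exact ⟨i :: A, B, by simp; omega, by simp [he, mul_assoc]⟩
    | dual j =>
      obtain ⟨A', j', hl', he'⟩ := u_dual_mul_uWord_pos A j
      refine ⟨A', j' :: B, by simp; omega, ?_⟩
      rw [uWord_cons, he, ← mul_assoc, he', List.map_cons, uWord_cons, mul_assoc]

/-- Up to a factor `t`, the element `a` is the monomial of a word of length `n - 2`. -/
def Contracts (a : PlacticAlgebra) (n : ℕ) : Prop :=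
  ∃ w : List Letter, w.length + 2 = n ∧ a = (LaurentPolynomial.T 1 : Ground) • uWord w

theorem Contracts.mul_uWord {a : PlacticAlgebra} {n : ℕ} (h : Contracts a n) (w : List Letter) :
    Contracts (a * uWord w) (n + w.length) := by
  obtain ⟨v, hv, rfl⟩ := h
  exact ⟨v ++ w, by simp; omega, by rw [uWord_append, smul_mul_assoc]⟩

theorem Contracts.uWord_mul {a : PlacticAlgebra} {n : ℕ} (h : Contracts a n) (w : List Letter) :
    Contracts (uWord w * a) (w.length + n) := by
  obtain ⟨v, hv, rfl⟩ := h
  exact ⟨w ++ v, by simp; omega, by rw [uWord_append, mul_smul_comm]⟩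

/-- Moving a dual letter to the left through a column. -/
theorem uWord_pos_mul_u_dual (A : List ℕ+) : ∀ b : ℕ+, A.Pairwise (· < ·) →
    Contracts (uWord (A.map .pos) * u (.dual b)) (A.length + 1) ∨
    ∃ (c : ℕ+) (A' : List ℕ+), A'.length = A.length ∧ A'.Pairwise (· < ·) ∧
      uWord (A.map .pos) * u (.dual b) = u (.dual c) * uWord (A'.map .pos) ∧
      b ∉ A' ∧ (∀ x ∈ A', b < x → x ∈ A) ∧ (∀ x ∈ A', ∃ y ∈ A, x ≤ y) ∧
      ∀ k, A.countP (· ≤ k) ≤ A'.countP (· ≤ k) := by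
  -- Of the invariants, the bound by entries of `A` keeps the new column strict; `b ∉ A'` and the
  -- origin of entries above `b` give disjointness from a whole dual column.
  induction A using List.reverseRecOn with
  | nil => intro b _; exact Or.inr ⟨b, [], by simp⟩
  | append_singleton A a ih =>
    intro b hs
    obtain ⟨hA, -, hlt⟩ := List.pairwise_append.1 hs
    simp only [List.mem_singleton, forall_eq] at hlt
    by_cases hab : a = b
    · subst hab
      by_cases ha : a = 1
      · subst ha
        left
        refine ⟨A.map .pos, by simp, ?_⟩
        simp only [List.map_append, List.map_cons, List.map_nil, uWord_append, uWord_cons,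
          uWord_nil, mul_one, mul_assoc, u_pos_one_mul_u_dual_one]
        rw [← Algebra.commutes, Algebra.smul_def]
      · obtain ⟨p, rfl⟩ := PNat.exists_eq_succ_of_ne_one ha
        have he : uWord ((A ++ [p + 1]).map .pos) * u (.dual (p + 1)) =
            uWord (A.map .pos) * u (.dual p) * u (.pos p) := by
          simp [mul_assoc, u_pos_mul_u_dual_succ]
        rw [he]
        rcases ih p hA with h | ⟨c, A', hl, hs', he', hb, hgt, hle, hc⟩
        · left
          simpa using h.mul_uWord [.pos p]
        · right
          -- Entries of `A'` are bounded by entries of `A`, hence `≤ p`, and `p` itself is excluded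
          -- because `p^∨` has just crossed.
          have hlt' : ∀ x ∈ A', x < p := by
            intro x hx
            obtain ⟨y, hy, hxy⟩ := hle x hx
            have : x ≤ p := PNat.lt_add_one_iff.1 (hxy.trans_lt (hlt y hy))
            exact lt_of_le_of_ne this (by rintro rfl; exact hb hx)
          have hp : p < p + 1 := PNat.lt_add_right p 1
          refine ⟨c, A' ++ [p], by simp [hl], ?_, ?_, ?_, ?_, ?_, ?_⟩
          · exact List.pairwise_append.2 ⟨hs', by simp, by simpa using hlt'⟩
          · rw [he']; simp [mul_assoc]
          · simp only [List.mem_append, List.mem_singleton, not_or]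
            exact ⟨fun h => absurd (hlt' _ h) (not_lt.2 hp.le), hp.ne'⟩
          · intro x hx hpx
            exfalso
            rcases List.mem_append.1 hx with hx | hx
            · exact absurd ((hlt' x hx).trans hp) hpx.not_gt
            · rw [List.mem_singleton.1 hx] at hpx
              exact absurd hp hpx.not_gt
          · intro x hx
            rcases List.mem_append.1 hx with hx | hx
            · obtain ⟨y, hy, hxy⟩ := hle x hx
              exact ⟨y, by simp [hy], hxy⟩
            · rw [List.mem_singleton.1 hx]
              exact ⟨p + 1, by simp, hp.le⟩
          · intro k
            have := hc k
            simp only [List.countP_append, List.countP_singleton, decide_eq_true_eq]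
            split_ifs with h₁ h₂
            · omega
            · exact absurd (hp.le.trans h₁) h₂
            · omega
            · omega
    · have he : uWord ((A ++ [a]).map .pos) * u (.dual b) =
          uWord (A.map .pos) * u (.dual b) * u (.pos a) := by
        simp [mul_assoc, u_pos_mul_u_dual_of_ne hab]
      rw [he]
      rcases ih b hA with h | ⟨c, A', hl, hs', he', hb, hgt, hle, hc⟩
      · left
        simpa using h.mul_uWord [.pos a]
      · right
        refine ⟨c, A' ++ [a], by simp [hl], ?_, ?_, ?_, ?_, ?_, ?_⟩
        · refine List.pairwise_append.2 ⟨hs', by simp, ?_⟩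
          intro x hx z hz
          rw [List.mem_singleton.1 hz]
          obtain ⟨y, hy, hxy⟩ := hle x hx
          exact hxy.trans_lt (hlt y hy)
        · rw [he']; simp [mul_assoc]
        · simp only [List.mem_append, List.mem_singleton, not_or]
          exact ⟨hb, Ne.symm hab⟩
        · intro x hx hbx
          rcases List.mem_append.1 hx with hx | hx
          · simp [hgt x hx hbx]
          · simp [List.mem_singleton.1 hx]
        · intro x hx
          rcases List.mem_append.1 hx with hx | hx
          · obtain ⟨y, hy, hxy⟩ := hle x hx
            exact ⟨y, by simp [hy], hxy⟩
          · exact ⟨x, by simp [List.mem_singleton.1 hx], le_rfl⟩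
        · intro k
          simpa only [List.countP_append] using Nat.add_le_add_right (hc k) _

/-- Moving a dual column to the left through a column. -/
theorem uWord_pos_mul_uWord_dual (B : List ℕ+) : ∀ A : List ℕ+, A.Pairwise (· < ·) →
    B.Pairwise (· > ·) →
    Contracts (uWord (A.map .pos) * uWord (B.map .dual)) (A.length + B.length) ∨
    ∃ A' : List ℕ+, A'.Pairwise (· < ·) ∧ (∀ b ∈ B, b ∉ A') ∧
      (∀ x ∈ A', (∀ b ∈ B, b < x) → x ∈ A) ∧
      ∀ k, A.countP (· ≤ k) ≤ A'.countP (· ≤ k) := by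
  induction B with
  | nil => intro A hA _; exact Or.inr ⟨A, hA, by simp⟩
  | cons b B ih =>
    intro A hA hB
    obtain ⟨hb, hB'⟩ := List.pairwise_cons.1 hB
    rcases uWord_pos_mul_u_dual A b hA with h | ⟨c, A₁, hl, hs, he, hb₁, hgt₁, -, hc₁⟩
    · left
      have := h.mul_uWord (B.map .dual)
      rw [mul_assoc, ← uWord_cons] at this
      simpa [add_assoc, add_comm, add_left_comm] using this
    · rcases ih A₁ hs hB' with h | ⟨A₂, hs₂, hb₂, hgt₂, hc₂⟩
      · left
        have := h.uWord_mul [.dual c]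
        rw [uWord_cons, uWord_nil, mul_one, ← mul_assoc, ← he, mul_assoc, ← uWord_cons] at this
        simpa [hl, add_assoc, add_comm, add_left_comm] using this
      · right
        refine ⟨A₂, hs₂, ?_, ?_, fun k => (hc₁ k).trans (hc₂ k)⟩
        · intro x hx
          rcases List.mem_cons.1 hx with rfl | hx
          -- The dual column descends, so `x` exceeds all later letters; if it were in `A₂`, it
          -- would already lie in `A₁`.
          · exact fun h => hb₁ (hgt₂ x h hb)
          · exact hb₂ x hx
        · intro x hx hlt
          exact hgt₁ x (hgt₂ x hx fun y hy => hlt y (by simp [hy])) (hlt b (by simp))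

/-- The entries counted are distinct elements of `{1, …, k}`. -/
theorem countP_le_add_countP_le {A B : List ℕ+} (hA : A.Nodup) (hB : B.Nodup)
    (h : ∀ b ∈ B, b ∉ A) (k : ℕ+) :
    A.countP (· ≤ k) + B.countP (· ≤ k) ≤ (k : ℕ) := by
  have hn : ((A ++ B).filter (· ≤ k)).Nodup :=
    (List.nodup_append.2 ⟨hA, hB, fun a ha b hb hab => h b hb (hab ▸ ha)⟩).filter _
  rw [← List.countP_append, List.countP_eq_length_filter, ← List.toFinset_card_of_nodup hn]
  calc _ ≤ (Finset.Icc 1 k).card := Finset.card_le_card fun x hx => by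
        simp only [List.mem_toFinset, List.mem_filter, decide_eq_true_eq] at hx
        exact Finset.mem_Icc.2 ⟨one_le, hx.2⟩
    _ = k := by simp

/-- If two columns violate the condition on rational tableaux, the product of their monomials
contracts. -/
theorem contracts_or_countP_le {A B : List ℕ+} (hA : A.Pairwise (· < ·))
    (hB : B.Pairwise (· < ·)) :
    Contracts (uWord (A.map .pos) * uWord (B.reverse.map .dual)) (A.length + B.length) ∨
    ∀ k : ℕ+, A.countP (· ≤ k) + B.countP (· ≤ k) ≤ (k : ℕ) := by
  rcases uWord_pos_mul_uWord_dual B.reverse A hA (List.pairwise_reverse.2 hB) with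
    h | ⟨A', hs, hd, -, hc⟩
  · left; simpa using h
  · right
    intro k
    refine (Nat.add_le_add_right (hc k) _).trans
      (countP_le_add_countP_le (hs.imp ne_of_lt) (hB.imp ne_of_lt) ?_ k)
    simpa using hd

theorem exists_columnLists (w : List Letter) : ∃ Cs Ds : List (List ℕ+),
    IsColumnList Cs ∧ IsColumnList Ds ∧ Cs.flatten.length + Ds.flatten.length = w.length ∧
      uWord w = uWord (Cs.reverse.flatten.map .pos) *
        uWord (Ds.reverse.flatten.reverse.map .dual) := by
  obtain ⟨A, B, hl, he⟩ := exists_uWord_eq_pos_mul_dual w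
  obtain ⟨Cs, hCs, hlC, hpC⟩ := isPlactic_u_pos.exists_isColumnList A
  obtain ⟨Ds, hDs, hlD, hpD⟩ := isPlactic_op_u_dual.exists_isColumnList B.reverse
  refine ⟨Cs, Ds, hCs, hDs, by rw [List.length_reverse] at hlD; omega, ?_⟩
  rw [he]
  congr 1
  · simp only [uWord, List.map_map]
    exact hpC.symm
  · have := congrArg MulOpposite.unop hpD
    simp only [MulOpposite.unop_list_prod, List.map_map, ← List.map_reverse,
      List.reverse_reverse] at this
    simp only [uWord, List.map_map]
    exact this.symm

theorem IsColumnList.pairwise_headD {Cs : List (List ℕ+)} (h : IsColumnList Cs) :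
    (Cs.headD []).Pairwise (· < ·) := by
  cases Cs with
  | nil => simp
  | cons C Cs => exact h.pairwise_lt C (by simp)

/-- The leftmost column is read last; splitting it off from both tableaux exposes the two adjacent
columns to be contracted. -/
theorem flatten_reverse_eq (Cs : List (List ℕ+)) :
    Cs.reverse.flatten = Cs.tail.reverse.flatten ++ Cs.headD [] := by
  cases Cs <;> simp

theorem length_flatten_eq (Cs : List (List ℕ+)) :
    Cs.flatten.length = Cs.tail.reverse.flatten.length + (Cs.headD []).length := by
  rw [← List.length_append, ← flatten_reverse_eq]
  simp

/-- Rational tableaux span the plactic algebra: every word monomial is, up to a power of `t`, the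
monomial of a rational tableau. -/
theorem exists_rationalTableau (w : List Letter) :
    ∃ (μ ν : YoungDiagram) (P : RationalTableau μ ν) (ε : ℕ),
      w.length = μ.card + ν.card + 2 * ε ∧
      uWord w =
        (LaurentPolynomial.T (ε : ℤ) : Ground) • uTableau P := by
  induction hn : w.length using Nat.strong_induction_on generalizing w with
  | _ n ih =>
    subst hn
    obtain ⟨Cs, Ds, hC, hD, hl, he⟩ := exists_columnLists w
    rcases contracts_or_countP_le hC.pairwise_headD hD.pairwise_headD with h | h
    -- Contraction need not preserve the tableau form, so the induction hypothesis is applied to the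
    -- shorter word `v` as an arbitrary word.
    · have h' := (h.uWord_mul (Cs.tail.reverse.flatten.map .pos)).mul_uWord
        (Ds.tail.reverse.flatten.reverse.map .dual)
      have he' : uWord w = uWord (Cs.tail.reverse.flatten.map .pos) *
          (uWord ((Cs.headD []).map .pos) * uWord ((Ds.headD []).reverse.map .dual)) *
          uWord (Ds.tail.reverse.flatten.reverse.map .dual) := by
        rw [he, flatten_reverse_eq Cs, flatten_reverse_eq Ds, List.reverse_append,
          List.map_append, List.map_append, uWord_append, uWord_append]
        simp only [mul_assoc]
      rw [← he'] at h'
      obtain ⟨v, hv, hwv⟩ := h'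
      rw [length_flatten_eq Cs, length_flatten_eq Ds] at hl
      simp only [List.length_map, List.length_reverse] at hv
      obtain ⟨μ, ν, P, ε, hlen, hP⟩ := ih v.length (by omega) v rfl
      refine ⟨μ, ν, P, ε + 1, by omega, ?_⟩
      rw [hwv, hP, smul_smul, ← LaurentPolynomial.T_add]
      push_cast
      rw [add_comm]
    · refine ⟨shape Cs hC, shape Ds hD, ⟨tableau Cs hC, tableau Ds hD, fun k => ?_⟩, 0, ?_, ?_⟩
      · rw [card_filter_entry_tableau, card_filter_entry_tableau]
        exact h k
      · rw [card_shape, card_shape]; omega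
      · simp [uTableau, colWord_tableau, dualColWord_tableau, he]

end Relations

end RationalPlactic

theorem mainTheorem6 (w : List RationalPlactic.Letter) :
    ∃ (μ ν : YoungDiagram) (P : RationalPlactic.RationalTableau μ ν) (ε : ℕ),
      w.length = μ.card + ν.card + 2 * ε ∧
      RationalPlactic.uWord w =
        (LaurentPolynomial.T (ε : ℤ) : RationalPlactic.Ground) • RationalPlactic.uTableau P :=
  RationalPlactic.exists_rationalTableau w
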